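/- Let $\kappa\ge 0$ be a real number and let $\mathcal L^T(-1,\kappa)$ be the one-dimensional transmission complex Airy operator, that is, the unbounded operator $$\mathcal L^T(-1,\kappa)\,(u_-,u_+)=\bigl(-u_-''-ix\,u_-,\;-u_+''-ix\,u_+\bigr)$$ on the complex Hilbert space $L^2(\mathbb R_-)\times L^2(\mathbb R_+)$, with domain $$\bigl\{(u_-,u_+)\in H^2(\mathbb R_-)\times H^2(\mathbb R_+)\;:\;(x u_-,x u_+)\in L^2(\mathbb R_-)\times L^2(\mathbb R_+),\;\; u_+'(0)=u_-'(0)=\kappa\,(u_+(0)-u_-(0))\bigr\}.$$ Then all eigenvalues of $\mathcal L^T(-1,\kappa)$ are simple: for every eigenvalue $\mu$, the generalized eigenspace $\bigcup_{n\ge 1}\ker(\mathcal L^T(-1,\kappa)-\mu)^n$ has dimension one. -/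

import Mathlib

open MeasureTheory Set Topology
open scoped ENNReal ContDiff

noncomputable section

namespace TransmissionAiry

/-- The complex Hilbert space `L²(I)` for a subset `I` of the real line. -/
abbrev L2On (I : Set ℝ) : Type := Lp ℂ 2 (volume.restrict I)

/-- `v` is the weak derivative of `u` on the open set `I` (both in `L²(I)`): one has
`∫_I φ' u = - ∫_I φ v` for every smooth test function `φ` with compact support in `I`. -/
def IsWeakDeriv (I : Set ℝ) (u v : L2On I) : Prop :=
  ∀ φ : ℝ → ℝ, ContDiff ℝ ∞ φ → HasCompactSupport φ → tsupport φ ⊆ I →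
    ∫ x in I, deriv φ x • u x = -∫ x in I, φ x • v x

/-- `a` is the boundary value at `0` of `u ∈ L²(I)`: the class `u` has a representative which is
continuous on the closure of `I` and takes the value `a` at `0`.  (For `I` one of the two open
half-lines, every `u ∈ H¹(I)` has exactly one boundary value.) -/
def HasBoundaryValue (I : Set ℝ) (u : L2On I) (a : ℂ) : Prop :=
  ∃ w : ℝ → ℂ, ContinuousOn w (closure I) ∧ u =ᵐ[volume.restrict I] w ∧ w 0 = a

/-- `u ∈ H²(I)` and `x u ∈ L²(I)`, with `u' = p`, `u'' = q`, `x u = r`, `u(0) = a`, `u'(0) = b`. -/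
structure HalfLineData (I : Set ℝ) (u p q r : L2On I) (a b : ℂ) : Prop where
  deriv_fst : IsWeakDeriv I u p
  deriv_snd : IsWeakDeriv I p q
  mul_x : r =ᵐ[volume.restrict I] fun x => (x : ℂ) * u x
  value : HasBoundaryValue I u a
  deriv_value : HasBoundaryValue I p b

/-- The Hilbert space `L²(ℝ₋) × L²(ℝ₊)`. -/
abbrev H : Type := WithLp 2 (L2On (Iio 0) × L2On (Ioi 0))

/-- The graph of the transmission Airy operator with parameters `j`, `κ`.  The pair
`u = (u₋, u₊)` lies in `H²(ℝ₋) × H²(ℝ₊)`, `x u` lies in `L²(ℝ₋) × L²(ℝ₊)`, the transmission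
condition `u₊'(0) = u₋'(0) = κ (u₊(0) - u₋(0))` holds, and
`f = (-u₋'' + i j x u₋, -u₊'' + i j x u₊)`. -/
def InGraph (j κ : ℝ) (u f : H) : Prop :=
  ∃ (pm qm rm : L2On (Iio 0)) (pp qp rp : L2On (Ioi 0)) (am bm ap bp : ℂ),
    HalfLineData (Iio 0) u.fst pm qm rm am bm ∧
    HalfLineData (Ioi 0) u.snd pp qp rp ap bp ∧
    bp = bm ∧ bm = (κ : ℂ) * (ap - am) ∧
    f.fst = -qm + (Complex.I * (j : ℂ)) • rm ∧
    f.snd = -qp + (Complex.I * (j : ℂ)) • rp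

/-! Linearity and uniqueness, needed to turn the graph into an operator. -/

theorem integrableOn_smul_of_test {I : Set ℝ} {φ : ℝ → ℝ} (hφ : Continuous φ)
    (hc : HasCompactSupport φ) (u : L2On I) :
    Integrable (fun x => φ x • u x) (volume.restrict I) := by
  have h1 : MemLp φ 2 (volume.restrict I) := (hφ.memLp_of_hasCompactSupport hc).restrict I
  have h2 : MemLp u 2 (volume.restrict I) := Lp.memLp u
  exact memLp_one_iff_integrable.1 (h2.smul h1)

theorem IsWeakDeriv.add {I : Set ℝ} {u v u' v' : L2On I} (h : IsWeakDeriv I u v)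
    (h' : IsWeakDeriv I u' v') : IsWeakDeriv I (u + u') (v + v') := by
  intro φ hφ hc hs
  have hd : Continuous (deriv φ) := hφ.continuous_deriv (by simp)
  have e1 : ∫ x in I, deriv φ x • (u + u') x
      = ∫ x in I, (deriv φ x • u x + deriv φ x • u' x) := by
    apply integral_congr_ae
    filter_upwards [Lp.coeFn_add u u'] with x hx
    rw [hx, Pi.add_apply, smul_add]
  have e2 : ∫ x in I, φ x • (v + v') x = ∫ x in I, (φ x • v x + φ x • v' x) := by
    apply integral_congr_ae
    filter_upwards [Lp.coeFn_add v v'] with x hx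
    rw [hx, Pi.add_apply, smul_add]
  rw [e1, e2, integral_add (integrableOn_smul_of_test hd hc.deriv u)
    (integrableOn_smul_of_test hd hc.deriv u'),
    integral_add (integrableOn_smul_of_test hφ.continuous hc v)
    (integrableOn_smul_of_test hφ.continuous hc v'), h φ hφ hc hs, h' φ hφ hc hs]
  ring

theorem IsWeakDeriv.smul {I : Set ℝ} {u v : L2On I} (c : ℂ) (h : IsWeakDeriv I u v) :
    IsWeakDeriv I (c • u) (c • v) := by
  intro φ hφ hc hs
  have e1 : ∫ x in I, deriv φ x • (c • u) x = ∫ x in I, c • (deriv φ x • u x) := by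
    apply integral_congr_ae
    filter_upwards [Lp.coeFn_smul c u] with x hx
    rw [hx, Pi.smul_apply, smul_comm]
  have e2 : ∫ x in I, φ x • (c • v) x = ∫ x in I, c • (φ x • v x) := by
    apply integral_congr_ae
    filter_upwards [Lp.coeFn_smul c v] with x hx
    rw [hx, Pi.smul_apply, smul_comm]
  rw [e1, e2, integral_smul, integral_smul, h φ hφ hc hs, smul_neg]

theorem IsWeakDeriv.unique {I : Set ℝ} (hI : IsOpen I) {u v w : L2On I}
    (h : IsWeakDeriv I u v) (h' : IsWeakDeriv I u w) : v = w := by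
  have key : ∀ᵐ x, x ∈ I → (v x - w x) = 0 := by
    refine hI.ae_eq_zero_of_integral_contDiff_smul_eq_zero (f := fun x => v x - w x) ?_ ?_
    · have hv : MemLp (fun x => v x - w x) 2 (volume.restrict I) :=
        (Lp.memLp v).sub (Lp.memLp w)
      exact (locallyIntegrableOn_of_locallyIntegrable_restrict
        (hv.locallyIntegrable (by norm_num)))
    · intro φ hφ hc hs
      have e : ∫ x, φ x • (v x - w x) = ∫ x in I, φ x • (v x - w x) := by
        symm
        apply setIntegral_eq_integral_of_forall_compl_eq_zero
        intro x hx
        have : φ x = 0 := image_eq_zero_of_notMem_tsupport (fun hx' => hx (hs hx'))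
        simp [this]
      have e' : ∫ x in I, φ x • (v x - w x) = ∫ x in I, (φ x • v x - φ x • w x) := by
        simp only [smul_sub]
      rw [e, e', integral_sub (integrableOn_smul_of_test hφ.continuous hc v)
        (integrableOn_smul_of_test hφ.continuous hc w), sub_eq_zero]
      have h1 := h φ hφ hc hs
      have h2 := h' φ hφ hc hs
      exact neg_injective (h1.symm.trans h2)
  apply Lp.ext
  filter_upwards [(ae_restrict_iff' hI.measurableSet).2 key] with x hx
  exact sub_eq_zero.1 hx

theorem HasBoundaryValue.add {I : Set ℝ} {u v : L2On I} {a b : ℂ}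
    (h : HasBoundaryValue I u a) (h' : HasBoundaryValue I v b) :
    HasBoundaryValue I (u + v) (a + b) := by
  obtain ⟨w, hw, he, h0⟩ := h
  obtain ⟨w', hw', he', h0'⟩ := h'
  refine ⟨fun x => w x + w' x, hw.add hw', ?_, by simp [h0, h0']⟩
  filter_upwards [Lp.coeFn_add u v, he, he'] with x h1 h2 h3
  rw [h1, Pi.add_apply, h2, h3]

theorem HasBoundaryValue.smul {I : Set ℝ} {u : L2On I} {a : ℂ} (c : ℂ)
    (h : HasBoundaryValue I u a) : HasBoundaryValue I (c • u) (c * a) := by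
  obtain ⟨w, hw, he, h0⟩ := h
  refine ⟨fun x => c * w x, continuousOn_const.mul hw, ?_, by simp [h0]⟩
  filter_upwards [Lp.coeFn_smul c u, he] with x h1 h2
  rw [h1, Pi.smul_apply, h2, smul_eq_mul]

theorem HalfLineData.add {I : Set ℝ} {u p q r u' p' q' r' : L2On I} {a b a' b' : ℂ}
    (h : HalfLineData I u p q r a b) (h' : HalfLineData I u' p' q' r' a' b') :
    HalfLineData I (u + u') (p + p') (q + q') (r + r') (a + a') (b + b') where
  deriv_fst := h.deriv_fst.add h'.deriv_fst
  deriv_snd := h.deriv_snd.add h'.deriv_snd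
  mul_x := by
    filter_upwards [Lp.coeFn_add u u', Lp.coeFn_add r r', h.mul_x, h'.mul_x] with x h1 h2 h3 h4
    rw [h1, h2, Pi.add_apply, Pi.add_apply, h3, h4, mul_add]
  value := h.value.add h'.value
  deriv_value := h.deriv_value.add h'.deriv_value

theorem HalfLineData.smul {I : Set ℝ} {u p q r : L2On I} {a b : ℂ} (c : ℂ)
    (h : HalfLineData I u p q r a b) :
    HalfLineData I (c • u) (c • p) (c • q) (c • r) (c * a) (c * b) where
  deriv_fst := h.deriv_fst.smul c
  deriv_snd := h.deriv_snd.smul c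
  mul_x := by
    filter_upwards [Lp.coeFn_smul c u, Lp.coeFn_smul c r, h.mul_x] with x h1 h2 h3
    simp only [h1, h2, h3, Pi.smul_apply, smul_eq_mul]
    ring
  value := h.value.smul c
  deriv_value := h.deriv_value.smul c

theorem InGraph.add {j κ : ℝ} {u f v g : H} (h : InGraph j κ u f) (h' : InGraph j κ v g) :
    InGraph j κ (u + v) (f + g) := by
  obtain ⟨pm, qm, rm, pp, qp, rp, am, bm, ap, bp, hm, hp, e1, e2, e3, e4⟩ := h
  obtain ⟨pm', qm', rm', pp', qp', rp', am', bm', ap', bp', hm', hp', e1', e2', e3', e4'⟩ := h'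
  refine ⟨_, _, _, _, _, _, _, _, _, _, hm.add hm', hp.add hp', by rw [e1, e1'], ?_, ?_, ?_⟩
  · rw [e2, e2']; ring
  · rw [WithLp.add_fst, e3, e3', smul_add]; abel
  · rw [WithLp.add_snd, e4, e4', smul_add]; abel

theorem InGraph.smul {j κ : ℝ} {u f : H} (c : ℂ) (h : InGraph j κ u f) :
    InGraph j κ (c • u) (c • f) := by
  obtain ⟨pm, qm, rm, pp, qp, rp, am, bm, ap, bp, hm, hp, e1, e2, e3, e4⟩ := h
  refine ⟨_, _, _, _, _, _, _, _, _, _, hm.smul c, hp.smul c, by rw [e1], ?_, ?_, ?_⟩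
  · rw [e2]; ring
  · rw [WithLp.smul_fst, e3, smul_add, smul_neg, smul_comm c]
  · rw [WithLp.smul_snd, e4, smul_add, smul_neg, smul_comm c]

theorem HalfLineData.unique {I : Set ℝ} (hI : IsOpen I) {u p q r p' q' r' : L2On I}
    {a b a' b' : ℂ} (h : HalfLineData I u p q r a b) (h' : HalfLineData I u p' q' r' a' b') :
    q = q' ∧ r = r' := by
  have hp : p = p' := h.deriv_fst.unique hI h'.deriv_fst
  subst hp
  exact ⟨h.deriv_snd.unique hI h'.deriv_snd, Lp.ext (h.mul_x.trans h'.mul_x.symm)⟩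

theorem InGraph.unique {j κ : ℝ} {u f g : H} (h : InGraph j κ u f) (h' : InGraph j κ u g) :
    f = g := by
  obtain ⟨pm, qm, rm, pp, qp, rp, am, bm, ap, bp, hm, hp, e1, e2, e3, e4⟩ := h
  obtain ⟨pm', qm', rm', pp', qp', rp', am', bm', ap', bp', hm', hp', e1', e2', e3', e4'⟩ := h'
  obtain ⟨h1, h2⟩ := hm.unique isOpen_Iio hm'
  obtain ⟨h3, h4⟩ := hp.unique isOpen_Ioi hp'
  refine WithLp.ofLp_injective 2 (Prod.ext ?_ ?_)
  · change f.fst = g.fst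
    rw [e3, e3', h1, h2]
  · change f.snd = g.snd
    rw [e4, e4', h3, h4]

theorem inGraph_zero (j κ : ℝ) : InGraph j κ 0 0 := by
  have hw : ∀ I : Set ℝ, IsWeakDeriv I 0 0 := by
    intro I φ _ _ _
    have e : ∀ ψ : ℝ → ℝ, ∫ x in I, ψ x • (0 : L2On I) x = 0 := by
      intro ψ
      rw [← integral_zero ℝ ℂ (μ := volume.restrict I)]
      apply integral_congr_ae
      filter_upwards [Lp.coeFn_zero ℂ 2 (volume.restrict I)] with x hx
      rw [hx, Pi.zero_apply, smul_zero]
    rw [e, e, neg_zero]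
  have hb : ∀ I : Set ℝ, HasBoundaryValue I 0 0 := fun I =>
    ⟨fun _ => 0, continuousOn_const, Lp.coeFn_zero ℂ 2 (volume.restrict I), rfl⟩
  have hd : ∀ I : Set ℝ, HalfLineData I 0 0 0 0 0 0 := fun I =>
    ⟨hw I, hw I, by
      filter_upwards [Lp.coeFn_zero ℂ 2 (volume.restrict I)] with x hx
      rw [hx, Pi.zero_apply, mul_zero], hb I, hb I⟩
  exact ⟨0, 0, 0, 0, 0, 0, 0, 0, 0, 0, hd _, hd _, rfl, by simp, by simp, by simp⟩

/-- The transmission Airy operator `-d²/dx² + i j x`, as an unbounded operator on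
`L²(ℝ₋) × L²(ℝ₊)` with domain
`{u ∈ H²(ℝ₋) × H²(ℝ₊) | x u ∈ L²(ℝ₋) × L²(ℝ₊), u₊'(0) = u₋'(0) = κ (u₊(0) - u₋(0))}`. -/
def airyT (j κ : ℝ) : H →ₗ.[ℂ] H where
  domain :=
    { carrier := {u | ∃ f, InGraph j κ u f}
      add_mem' := fun ⟨_, hf⟩ ⟨_, hg⟩ => ⟨_, hf.add hg⟩
      zero_mem' := ⟨0, inGraph_zero j κ⟩
      smul_mem' := fun c _ ⟨_, hf⟩ => ⟨_, hf.smul c⟩ }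
  toFun :=
    { toFun := fun u => Classical.choose u.2
      map_add' := fun u v => (Classical.choose_spec (u + v).2).unique
        ((Classical.choose_spec u.2).add (Classical.choose_spec v.2))
      map_smul' := fun c u => (Classical.choose_spec (c • u).2).unique
        ((Classical.choose_spec u.2).smul c) }

theorem airyT_inGraph (j κ : ℝ) (u : (airyT j κ).domain) : InGraph j κ u (airyT j κ u) :=
  Classical.choose_spec u.2

theorem airyT_eq_of_inGraph {j κ : ℝ} (u : (airyT j κ).domain) {f : H}
    (h : InGraph j κ u f) : airyT j κ u = f :=
  (airyT_inGraph j κ u).unique h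

end TransmissionAiry

/-! Eigenvalues and algebraic multiplicity for an unbounded operator. -/

namespace UnboundedOp

variable {E : Type*} [AddCommGroup E] [Module ℂ E]

/-- `μ` is an eigenvalue of `T`: there is a nonzero `u` in the domain with `T u = μ u`. -/
def IsEigenvalue (T : E →ₗ.[ℂ] E) (μ : ℂ) : Prop :=
  ∃ u : T.domain, u ≠ 0 ∧ T u = μ • (u : E)

/-- `ker (T - μ)ⁿ`, where a vector is in the domain of `(T - μ)ⁿ⁺¹` when it is in the domain of
`T` and its image under `T - μ` is in the domain of `(T - μ)ⁿ`. -/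
def kerPow (T : E →ₗ.[ℂ] E) (μ : ℂ) : ℕ → Submodule ℂ E
  | 0 => ⊥
  | n + 1 => ((kerPow T μ n).comap (T.toFun - μ • T.domain.subtype)).map T.domain.subtype

/-- The generalized eigenspace (root space) of `T` at `μ`, the union of all `ker (T - μ)ⁿ`. -/
def rootSpace (T : E →ₗ.[ℂ] E) (μ : ℂ) : Submodule ℂ E := ⨆ n, kerPow T μ n

/-- The eigenvalue `μ` of `T` is simple: it is an eigenvalue of algebraic multiplicity one. -/
def IsSimpleEigenvalue (T : E →ₗ.[ℂ] E) (μ : ℂ) : Prop :=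
  IsEigenvalue T μ ∧ Module.rank ℂ (rootSpace T μ) = 1

end UnboundedOp

end

open scoped ComplexConjugate

noncomputable section

namespace TransmissionAiry

/-! Reflect the left component to get two functions `w`, `w'` on the right half-line, solving the
equations with `c = i` and `c = -i`; then `P' 0 = -P 0` and `P 0 = κ (w 0 - w' 0)`. Suppose `(v,
v')` continues an eigenfunction to a Jordan chain. The Wronskian (`integral_sq_eq_wronskian`) and
the primitive `P² + (c x + μ) w²` of `c w²` (`mul_integral_sq`) each express the integral of `w²` by
boundary values. Comparing them on both sides, the Wronskian terms cancel by the transmission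
conditions, leaving `μ (w(0)² - w'(0)²) = 0`. If `μ = 0`, the real part of the energy identity and
`κ ≥ 0` force `P = P' = 0`, hence `w = w' = 0`. If `w 0 = ± w' 0`, the boundary term of the energy
is real, so its imaginary part makes one side vanish, namely the one where `Im c` and `Im μ` do not
have opposite signs; the zero Cauchy data then pass to the other side
(`eqOn_zero_of_boundary_eq_or_neg`). The case `w 0 = w' 0` also gives geometric simplicity: two
eigenfunctions have a combination without jump at `0`, and it must vanish. -/

/-! ### Weak derivatives of continuous functions on an interval. -/

/-- A test function on an interval with zero mean is the derivative of a test function. -/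
theorem exists_testFunction_deriv_eq {I : Set ℝ} (hconn : I.OrdConnected) {c : ℝ} (hc : c ∈ I)
    {θ : ℝ → ℝ} (hθ : ContDiff ℝ ∞ θ) (hcs : HasCompactSupport θ) (hs : tsupport θ ⊆ I)
    (h0 : ∫ x, θ x = 0) :
    ∃ Φ : ℝ → ℝ, ContDiff ℝ ∞ Φ ∧ HasCompactSupport Φ ∧ tsupport Φ ⊆ I ∧ deriv Φ = θ := by
  -- Adding `c` keeps the set nonempty when `θ = 0`, so both extremes lie in `I`.
  have hK : IsCompact (insert c (tsupport θ)) := IsCompact.insert hcs c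
  have hne : (insert c (tsupport θ)).Nonempty := insert_nonempty _ _
  have hKI : insert c (tsupport θ) ⊆ I := insert_subset hc hs
  set a := sInf (insert c (tsupport θ)) with ha
  set b := sSup (insert c (tsupport θ)) with hb
  have haI : a ∈ I := hKI (hK.sInf_mem hne)
  have hbI : b ∈ I := hKI (hK.sSup_mem hne)
  have hlow : ∀ x < a, θ x = 0 := fun x hx => image_eq_zero_of_notMem_tsupport fun h =>
    hx.not_ge (csInf_le hK.bddBelow (mem_insert_of_mem _ h))
  have hupp : ∀ x, b < x → θ x = 0 := fun x hx => image_eq_zero_of_notMem_tsupport fun h =>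
    hx.not_ge (le_csSup hK.bddAbove (mem_insert_of_mem _ h))
  -- The base point `a - 1` is strictly left of the support, so the half-open interval of
  -- integration misses none of it.
  have hder : ∀ x, HasDerivAt (fun x => ∫ t in (a - 1)..x, θ t) (θ x) x := fun x =>
    intervalIntegral.integral_hasDerivAt_right (hθ.continuous.intervalIntegrable _ _)
      (hθ.continuous.stronglyMeasurableAtFilter _ _) hθ.continuous.continuousAt
  have hderiv : deriv (fun x => ∫ t in (a - 1)..x, θ t) = θ := funext fun x => (hder x).deriv
  have hsupp : tsupport (fun x => ∫ t in (a - 1)..x, θ t) ⊆ Icc a b := by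
    refine closure_minimal (fun x hx => ?_) isClosed_Icc
    by_contra hxn
    refine hx ?_
    rcases lt_or_ge x a with h | h
    · change ∫ t in (a - 1)..x, θ t = 0
      rw [intervalIntegral.integral_congr (g := fun _ => (0 : ℝ)), intervalIntegral.integral_zero]
      intro t ht
      refine hlow t (lt_of_le_of_lt ht.2 ?_)
      exact max_lt (by linarith) h
    · have hbx : b < x := not_le.1 fun h' => hxn ⟨h, h'⟩
      change ∫ t in (a - 1)..x, θ t = 0
      rw [intervalIntegral.integral_eq_integral_of_support_subset, h0]
      intro t ht
      refine ⟨not_le.1 fun h' => ht (hlow t (by linarith)),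
        not_lt.1 fun h' => ht (hupp t (by linarith))⟩
  refine ⟨_, ?_, HasCompactSupport.of_support_subset_isCompact isCompact_Icc
    ((subset_tsupport _).trans hsupp), hsupp.trans (hconn.out haI hbI), hderiv⟩
  rw [contDiff_infty_iff_deriv, hderiv]
  exact ⟨fun x => (hder x).differentiableAt, hθ⟩

theorem setIntegral_smul_of_tsupport_subset {I : Set ℝ} {φ : ℝ → ℝ} (hs : tsupport φ ⊆ I)
    (h : ℝ → ℂ) : ∫ x in I, φ x • h x = ∫ x, φ x • h x := by
  apply setIntegral_eq_integral_of_forall_compl_eq_zero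
  intro x hx
  have : φ x = 0 := image_eq_zero_of_notMem_tsupport (fun hx' => hx (hs hx'))
  simp [this]

theorem integrable_smul_of_tsupport_subset {I : Set ℝ} {φ : ℝ → ℝ} (hφ : Continuous φ)
    (hc : HasCompactSupport φ) (hs : tsupport φ ⊆ I) {h : ℝ → ℂ} (hh : ContinuousOn h I) :
    Integrable (fun x => φ x • h x) := by
  have h1 : IntegrableOn (fun x => φ x • h x) (tsupport φ) :=
    (hφ.continuousOn.smul (hh.mono hs)).integrableOn_compact hc
  refine (integrableOn_iff_integrable_of_support_subset fun x hx => ?_).1 h1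
  refine subset_tsupport _ fun h0 => hx ?_
  simp [h0]

/-- The du Bois-Reymond lemma for continuous functions. -/
theorem exists_eqOn_const_of_integral_deriv_smul_eq_zero {I : Set ℝ} (hI : IsOpen I)
    (hconn : I.OrdConnected) {h : ℝ → ℂ} (hh : ContinuousOn h I)
    (hz : ∀ φ : ℝ → ℝ, ContDiff ℝ ∞ φ → HasCompactSupport φ → tsupport φ ⊆ I →
      ∫ x, deriv φ x • h x = 0) : ∃ C : ℂ, ∀ x ∈ I, h x = C := by
  rcases I.eq_empty_or_nonempty with rfl | ⟨c, hc⟩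
  · exact ⟨0, by simp⟩
  obtain ⟨ε, hε, hball⟩ := Metric.isOpen_iff.1 hI c hc
  let f : ContDiffBump c := ⟨ε / 4, ε / 2, by positivity, by linarith⟩
  have hψs : tsupport (f.normed volume) ⊆ I := by
    rw [f.tsupport_normed_eq]
    exact (Metric.closedBall_subset_ball (by change ε / 2 < ε; linarith)).trans hball
  have hψ : ContDiff ℝ ∞ (f.normed volume) := f.contDiff_normed
  have hψc : HasCompactSupport (f.normed volume) := f.hasCompactSupport_normed
  set ψ := f.normed volume with hψdef
  have hψ1 : ∫ x, ψ x = 1 := f.integral_normed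
  have hψi := integrable_smul_of_tsupport_subset hψ.continuous hψc hψs hh
  refine ⟨∫ x, ψ x • h x, ?_⟩
  set C := ∫ x, ψ x • h x with hC
  have hhC : ContinuousOn (fun x => h x - C) I := hh.sub continuousOn_const
  have key : ∀ᵐ x, x ∈ I → h x - C = 0 := by
    refine hI.ae_eq_zero_of_integral_contDiff_smul_eq_zero
      (hhC.locallyIntegrableOn hI.measurableSet) fun φ hφ hφc hφs => ?_
    set m := ∫ x, φ x with hm
    have hφi : Integrable φ := hφ.continuous.integrable_of_hasCompactSupport hφc
    have hψi' : Integrable ψ := hψ.continuous.integrable_of_hasCompactSupport hψc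
    have hmψ : HasCompactSupport (fun x => m * ψ x) := hψc.mul_left
    have hθs : tsupport (fun x => φ x - m * ψ x) ⊆ I :=
      (tsupport_sub _ _).trans (union_subset hφs ((tsupport_mul_subset_right).trans hψs))
    -- As `ψ` has integral `1`, subtracting `m ψ` makes the mean of `φ` zero; the hypothesis on
    -- derivatives then applies.
    obtain ⟨Φ, h1, h2, h3, h4⟩ := exists_testFunction_deriv_eq hconn hc
      (θ := fun x => φ x - m * ψ x) (hφ.sub (contDiff_const.mul hψ)) (hφc.sub hmψ) hθs (by
        rw [integral_sub hφi (hψi'.const_mul m), integral_const_mul, hψ1, ← hm]; ring)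
    have h5 := hz Φ h1 h2 h3
    rw [h4] at h5
    have hφhi := integrable_smul_of_tsupport_subset hφ.continuous hφc hφs hh
    have e : ∀ x, (φ x - m * ψ x) • h x = φ x • h x - m • (ψ x • h x) := fun x => by
      rw [sub_smul, mul_smul]
    simp only [e] at h5
    have hmψi : Integrable (fun x => m • (ψ x • h x)) := hψi.smul m
    rw [integral_sub hφhi hmψi, integral_smul, ← hC] at h5
    simp only [smul_sub]
    rw [integral_sub hφhi (hφi.smul_const C), integral_smul_const, ← hm, h5]
  have := Measure.eqOn_open_of_ae_eq (μ := volume) (f := fun x => h x - C) (g := fun _ => 0)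
    ((ae_restrict_iff' hI.measurableSet).2 key) hI hhC continuousOn_const
  exact fun x hx => sub_eq_zero.1 (this hx)

/-- A continuous function whose weak derivative on an open interval is continuous is
differentiable there. -/
theorem hasDerivAt_of_weakDeriv {I : Set ℝ} (hI : IsOpen I) (hconn : I.OrdConnected)
    {w P : ℝ → ℂ} (hw : ContinuousOn w I) (hP : ContinuousOn P I)
    (h : ∀ φ : ℝ → ℝ, ContDiff ℝ ∞ φ → HasCompactSupport φ → tsupport φ ⊆ I →
      ∫ x in I, deriv φ x • w x = -∫ x in I, φ x • P x) :
    ∀ x ∈ I, HasDerivAt w (P x) x := by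
  rcases I.eq_empty_or_nonempty with rfl | ⟨c, hc⟩
  · simp
  set G : ℝ → ℂ := fun x => ∫ t in c..x, P t with hG
  have hGd : ∀ x ∈ I, HasDerivAt G (P x) x := fun x hx =>
    intervalIntegral.integral_hasDerivAt_right
      ((hP.mono (hconn.uIcc_subset hc hx)).intervalIntegrable)
      (hP.stronglyMeasurableAtFilter hI x hx) (hP.continuousAt (hI.mem_nhds hx))
  have hGc : ContinuousOn G I := fun x hx => (hGd x hx).continuousAt.continuousWithinAt
  -- `w` and the primitive `G` of `P` have the same weak derivative, so they differ by a constant.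
  obtain ⟨C, hC⟩ := exists_eqOn_const_of_integral_deriv_smul_eq_zero hI hconn (hw.sub hGc)
    fun φ hφ hφc hφs => by
      have hd : Continuous (deriv φ) := hφ.continuous_deriv (by simp)
      have hds : tsupport (deriv φ) ⊆ I := (tsupport_deriv_subset (𝕜 := ℝ)).trans hφs
      have i1 := integrable_smul_of_tsupport_subset hd hφc.deriv hds hw
      have i2 := integrable_smul_of_tsupport_subset hd hφc.deriv hds hGc
      have i3 := integrable_smul_of_tsupport_subset hφ.continuous hφc hφs hP
      have i4 := integrable_smul_of_tsupport_subset hφ.continuous hφc hφs hGc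
      have e := h φ hφ hφc hφs
      rw [setIntegral_smul_of_tsupport_subset hds, setIntegral_smul_of_tsupport_subset hφs] at e
      have hsub : tsupport (fun x => ((φ x : ℝ) : ℂ)) ⊆ tsupport φ :=
        closure_mono fun y hy h0 => hy (by simp [h0])
      have e2 : ∫ x, ((φ x : ℝ) : ℂ) * P x = -∫ x, ((deriv φ x : ℝ) : ℂ) * G x := by
        refine integral_mul_deriv_eq_deriv_mul_of_integrable (u := fun x => ((φ x : ℝ) : ℂ))
          (u' := fun x => ((deriv φ x : ℝ) : ℂ)) (v := G) (v' := P)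
          (fun x _ => ((hφ.differentiable (by simp) x).hasDerivAt).ofReal_comp)
          (fun x hx => hGd x (hφs (hsub hx))) ?_ ?_ ?_
        · exact i3.congr (.of_forall fun x => by simp)
        · exact i2.congr (.of_forall fun x => by simp)
        · exact i4.congr (.of_forall fun x => by simp)
      simp only [Pi.sub_apply, smul_sub]
      rw [integral_sub i1 i2, e]
      simp only [Complex.real_smul]
      rw [e2]; ring
  intro x hx
  have h1 : HasDerivAt (fun y => G y + C) (P x) x := (hGd x hx).add_const C
  refine h1.congr_of_eventuallyEq ?_
  filter_upwards [hI.mem_nhds hx] with y hy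
  have := hC y hy
  simp only [Pi.sub_apply] at this
  rw [← this]; ring

/-! ### Classical solutions on a half-line and reflection. -/

/-- `w` is a classical solution on `I` of `-w'' - (c x + μ) w = g` with `w' = P`, such that `w`,
`w'` and `x w` are square integrable. -/
structure IsAirySolution (I : Set ℝ) (c μ : ℂ) (g w P : ℝ → ℂ) : Prop where
  continuousOn : ContinuousOn w (closure I)
  continuousOn_deriv : ContinuousOn P (closure I)
  hasDerivAt : ∀ x ∈ I, HasDerivAt w (P x) x
  hasDerivAt_deriv : ∀ x : ℝ, x ∈ I → HasDerivAt P (-(c * x + μ) * w x - g x) x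
  memLp : MemLp w 2 (volume.restrict I)
  memLp_deriv : MemLp P 2 (volume.restrict I)
  memLp_mul : MemLp (fun x : ℝ => (x : ℂ) * w x) 2 (volume.restrict I)

/-- The equation expresses `q` through `u`, `x u` and `g`, so `q` has a continuous representative;
the regularity lemma applied to `(w, P)` and then to `(P, q)` gives classical derivatives. -/
theorem HalfLineData.exists_isAirySolution {I : Set ℝ} (hI : IsOpen I) (hconn : I.OrdConnected)
    {u p q r f g : L2On I} {a b μ : ℂ} (h : HalfLineData I u p q r a b)
    (hf : f = -q + (Complex.I * ((-1 : ℝ) : ℂ)) • r) (hg : f = μ • u + g)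
    {γ : ℝ → ℂ} (hγ : ContinuousOn γ I) (hgγ : g =ᵐ[volume.restrict I] γ) :
    ∃ w P : ℝ → ℂ, IsAirySolution I Complex.I μ γ w P ∧ w 0 = a ∧ P 0 = b ∧
      u =ᵐ[volume.restrict I] w := by
  obtain ⟨w, hwc, huw, hw0⟩ := h.value
  obtain ⟨P, hPc, hpP, hP0⟩ := h.deriv_value
  have hwI := hwc.mono subset_closure
  have hPI := hPc.mono subset_closure
  have hq : q =ᵐ[volume.restrict I] fun x => -(Complex.I * x + μ) * w x - γ x := by
    have e : -q + (Complex.I * ((-1 : ℝ) : ℂ)) • r = μ • u + g := hf.symm.trans hg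
    have e' : q = (Complex.I * ((-1 : ℝ) : ℂ)) • r - (μ • u + g) := by rw [← e]; abel
    rw [e']
    filter_upwards [Lp.coeFn_sub ((Complex.I * ((-1 : ℝ) : ℂ)) • r) (μ • u + g),
      Lp.coeFn_add (μ • u) g, Lp.coeFn_smul μ u,
      Lp.coeFn_smul (Complex.I * ((-1 : ℝ) : ℂ)) r, h.mul_x, huw, hgγ] with x h1 h2 h3 h4 h5 h6 h7
    rw [h1, Pi.sub_apply, h2, Pi.add_apply, h3, h4, Pi.smul_apply, Pi.smul_apply, h5, h6, h7]
    simp only [smul_eq_mul]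
    push_cast
    ring
  have hqc : ContinuousOn (fun x : ℝ => -(Complex.I * x + μ) * w x - γ x) I := by
    refine ContinuousOn.sub (ContinuousOn.mul (Continuous.continuousOn ?_) hwI) hγ
    fun_prop
  have congr : ∀ {s : L2On I} {σ : ℝ → ℂ} (φ : ℝ → ℝ), s =ᵐ[volume.restrict I] σ →
      ∫ x in I, φ x • s x = ∫ x in I, φ x • σ x := fun φ hs =>
    integral_congr_ae (by filter_upwards [hs] with x hx; rw [hx])
  refine ⟨w, P, ⟨hwc, hPc, hasDerivAt_of_weakDeriv hI hconn hwI hPI ?_,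
    hasDerivAt_of_weakDeriv hI hconn hPI hqc ?_, (Lp.memLp u).ae_eq huw, (Lp.memLp p).ae_eq hpP,
    (Lp.memLp r).ae_eq ?_⟩, hw0, hP0, huw⟩
  · intro φ h1 h2 h3
    rw [← congr _ huw, ← congr _ hpP]
    exact h.deriv_fst φ h1 h2 h3
  · intro φ h1 h2 h3
    rw [← congr _ hpP, ← congr _ hq]
    exact h.deriv_snd φ h1 h2 h3
  · filter_upwards [h.mul_x, huw] with x h1 h2
    rw [h1, h2]

theorem measurePreserving_neg_Ioi_Iio : MeasurePreserving (fun x : ℝ => -x)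
    (volume.restrict (Ioi 0)) (volume.restrict (Iio 0)) := by
  have := (Measure.measurePreserving_neg (volume : Measure ℝ)).restrict_preimage
    (s := Iio (0 : ℝ)) measurableSet_Iio
  simpa [neg_preimage] using this

/-- Reflection `x ↦ -x` of a solution. -/
theorem IsAirySolution.reflect {c μ : ℂ} {g w P : ℝ → ℂ}
    (h : IsAirySolution (Iio 0) c μ g w P) :
    IsAirySolution (Ioi 0) (-c) μ (fun x => g (-x)) (fun x => w (-x)) (fun x => -P (-x)) := by
  have hm : MapsTo (fun x : ℝ => -x) (closure (Ioi 0)) (closure (Iio 0)) := by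
    intro x hx
    rw [closure_Ioi] at hx
    rw [closure_Iio]
    simpa using hx
  refine ⟨h.continuousOn.comp continuous_neg.continuousOn hm,
    (h.continuousOn_deriv.comp continuous_neg.continuousOn hm).neg, fun x hx => ?_, fun x hx => ?_,
    h.memLp.comp_measurePreserving measurePreserving_neg_Ioi_Iio,
    (h.memLp_deriv.comp_measurePreserving measurePreserving_neg_Ioi_Iio).neg, ?_⟩
  · have h1 := h.hasDerivAt (-x) (by simpa using hx)
    exact (h1.scomp x (hasDerivAt_neg x)).congr_deriv (by simp)
  · have h1 := h.hasDerivAt_deriv (-x) (by simpa using hx)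
    refine (h1.scomp x (hasDerivAt_neg x)).neg.congr_deriv ?_
    simp
  · convert (h.memLp_mul.comp_measurePreserving measurePreserving_neg_Ioi_Iio).neg using 1
    funext x
    simp

/-! ### Integral identities and Cauchy uniqueness on the right half-line. -/

/-- Integrability of both `F` and `F'` forces `F → 0` at infinity, so only the boundary term at `0`
survives. -/
theorem integral_Ioi_zero_eq_neg_of_hasDerivAt {F F' : ℝ → ℂ} (hc : ContinuousOn F (Ici 0))
    (hd : ∀ x ∈ Ioi (0 : ℝ), HasDerivAt F (F' x) x) (hF : IntegrableOn F (Ioi 0))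
    (hF' : IntegrableOn F' (Ioi 0)) : ∫ x in Ioi (0 : ℝ), F' x = -F 0 := by
  rw [integral_Ioi_of_hasDerivAt_of_tendsto (hc 0 self_mem_Ici) hd hF'
    (tendsto_zero_of_hasDerivAt_of_integrableOn_Ioi hd hF' hF), zero_sub]

namespace IsAirySolution

variable {c μ : ℂ} {g w P : ℝ → ℂ}

/-- Square integrability of `x w` is what puts `w''` in `L²`; all boundary terms at infinity are
discarded on this basis. -/
theorem memLp_deriv_deriv (h : IsAirySolution (Ioi 0) c μ g w P)
    (hg : MemLp g 2 (volume.restrict (Ioi 0))) :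
    MemLp (fun x : ℝ => -(c * x + μ) * w x - g x) 2 (volume.restrict (Ioi 0)) := by
  convert ((h.memLp_mul.const_mul (-c)).sub (h.memLp.const_mul μ)).sub hg using 1
  funext x
  simp only [Pi.sub_apply]
  ring

theorem continuousOn_Ici (h : IsAirySolution (Ioi 0) c μ g w P) : ContinuousOn w (Ici 0) := by
  simpa using h.continuousOn

theorem continuousOn_deriv_Ici (h : IsAirySolution (Ioi 0) c μ g w P) :
    ContinuousOn P (Ici 0) := by
  simpa using h.continuousOn_deriv

/-- A solution of the homogeneous equation with vanishing Cauchy data vanishes. -/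
theorem eq_zero_of_cauchy (h : IsAirySolution (Ioi 0) c μ 0 w P) (hw : w 0 = 0) (hP : P 0 = 0) :
    ∀ x ∈ Ioi (0 : ℝ), w x = 0 := by
  intro R hR
  have hR' : (0 : ℝ) < R := hR
  have hfc : ContinuousOn (fun x => (w x, P x)) (Ici 0) :=
    h.continuousOn_Ici.prodMk h.continuousOn_deriv_Ici
  have hd : ∀ x ∈ Ioi (0 : ℝ),
      HasDerivAt (fun x => (w x, P x)) (P x, -(c * x + μ) * w x) x := fun x hx => by
    have := (h.hasDerivAt x hx).prodMk (h.hasDerivAt_deriv x hx)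
    simpa using this
  have hf'c : ContinuousOn (fun x : ℝ => (P x, -(c * x + μ) * w x)) (Ici 0) :=
    h.continuousOn_deriv_Ici.prodMk (ContinuousOn.mul (by fun_prop) h.continuousOn_Ici)
  have hd' : ∀ x ∈ Ico (0 : ℝ) R,
      HasDerivWithinAt (fun x => (w x, P x)) (P x, -(c * x + μ) * w x) (Ici x) x := by
    intro x hx
    -- The equation holds only for `x > 0`; at `0` the right derivative is the limit of the
    -- derivatives.
    rcases hx.1.eq_or_lt with rfl | hx0
    · refine hasDerivWithinAt_Ici_of_tendsto_deriv (s := Ioi 0)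
        (fun y hy => (hd y hy).differentiableAt.differentiableWithinAt)
        ((hfc 0 self_mem_Ici).mono Ioi_subset_Ici_self) self_mem_nhdsWithin ?_
      refine (((hf'c 0 self_mem_Ici).mono Ioi_subset_Ici_self).tendsto).congr' ?_
      filter_upwards [self_mem_nhdsWithin] with y hy
      exact (hd y hy).deriv.symm
    · exact (hd x hx0).hasDerivWithinAt
  -- Grönwall for the first-order system `(w, P)` in the sup norm; `K` dominates the coefficients
  -- `1` and `c x + μ` on `[0, R]`.
  have := eq_zero_of_abs_deriv_le_mul_abs_self_of_eq_zero_right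
    (K := 1 + (‖c‖ * R + ‖μ‖)) (a := 0) (b := R) (hfc.mono Icc_subset_Ici_self) hd'
    (by simp [hw, hP]) (fun x hx => by
      have h1 : ‖w x‖ ≤ ‖(w x, P x)‖ := norm_fst_le (w x, P x)
      have h2 : ‖P x‖ ≤ ‖(w x, P x)‖ := norm_snd_le (w x, P x)
      have h3 : ‖-(c * x + μ)‖ ≤ ‖c‖ * R + ‖μ‖ := by
        rw [norm_neg]
        refine (norm_add_le _ _).trans ?_
        rw [norm_mul, Complex.norm_real, Real.norm_of_nonneg hx.1]
        gcongr
        exact hx.2.le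
      have h0 : 0 ≤ ‖c‖ * R + ‖μ‖ := by positivity
      have hN := norm_nonneg (w x, P x)
      rw [Prod.norm_mk]
      refine max_le ?_ ?_
      · nlinarith
      · rw [norm_mul]
        have := mul_le_mul h3 h1 (norm_nonneg _) h0
        nlinarith) R ⟨hR'.le, le_rfl⟩
  exact (Prod.mk.inj this).1

theorem integrable_energy (h : IsAirySolution (Ioi 0) c μ 0 w P) :
    IntegrableOn (fun x : ℝ => P x * conj (P x) - (c * x + μ) * (w x * conj (w x))) (Ioi 0) := by
  have hwconj : MemLp (fun x => conj (w x)) 2 (volume.restrict (Ioi 0)) := h.memLp.star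
  have hPconj : MemLp (fun x => conj (P x)) 2 (volume.restrict (Ioi 0)) := h.memLp_deriv.star
  have h2 := h.memLp_deriv_deriv MemLp.zero
  refine ((h.memLp_deriv.integrable_mul hPconj).add (h2.integrable_mul hwconj)).congr
    (.of_forall fun x => ?_)
  simp
  ring

/-- The energy identity. -/
theorem integral_energy (h : IsAirySolution (Ioi 0) c μ 0 w P) :
    ∫ x : ℝ in Ioi 0, (P x * conj (P x) - (c * x + μ) * (w x * conj (w x)))
      = -(P 0 * conj (w 0)) := by
  have hwconj : MemLp (fun x => conj (w x)) 2 (volume.restrict (Ioi 0)) := h.memLp.star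
  refine integral_Ioi_zero_eq_neg_of_hasDerivAt (F := fun x => P x * conj (w x))
    (h.continuousOn_deriv_Ici.mul (Complex.continuous_conj.comp_continuousOn h.continuousOn_Ici))
    (fun x hx => ?_) (h.memLp_deriv.integrable_mul hwconj) h.integrable_energy
  have hstar : HasDerivAt (fun x => conj (w x)) (conj (P x)) x := (h.hasDerivAt x hx).star
  refine ((h.hasDerivAt_deriv x hx).mul hstar).congr_deriv ?_
  simp
  ring

/-- The Wronskian identity for a Jordan chain `(w, v)`. -/
theorem integral_sq_eq_wronskian (h : IsAirySolution (Ioi 0) c μ 0 w P) {v Q : ℝ → ℂ}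
    (h' : IsAirySolution (Ioi 0) c μ w v Q) :
    ∫ x in Ioi (0 : ℝ), w x * w x = w 0 * Q 0 - P 0 * v 0 := by
  have h2 := h.memLp_deriv_deriv MemLp.zero
  have h2' := h'.memLp_deriv_deriv h.memLp
  -- Without conjugation the potential terms cancel, and only the source `w` of the second equation
  -- contributes to `F'`.
  have := integral_Ioi_zero_eq_neg_of_hasDerivAt (F := fun x => P x * v x - w x * Q x)
    (F' := fun x => w x * w x)
    ((h.continuousOn_deriv_Ici.mul h'.continuousOn_Ici).sub
      (h.continuousOn_Ici.mul h'.continuousOn_deriv_Ici))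
    (fun x hx => by
      refine (((h.hasDerivAt_deriv x hx).mul (h'.hasDerivAt x hx)).sub
        ((h.hasDerivAt x hx).mul (h'.hasDerivAt_deriv x hx))).congr_deriv ?_
      simp
      ring)
    ((h.memLp_deriv.integrable_mul h'.memLp).sub (h.memLp.integrable_mul h'.memLp_deriv))
    (h.memLp.integrable_mul h.memLp)
  rw [this]
  ring

/-- Along a solution, `P² + (c x + μ) w²` changes only through the explicit dependence of the
potential on `x`, so its derivative is `c w²`. -/
theorem mul_integral_sq (h : IsAirySolution (Ioi 0) c μ 0 w P) :
    c * ∫ x in Ioi (0 : ℝ), w x * w x = -(P 0 * P 0 + μ * (w 0 * w 0)) := by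
  have hi := h.memLp.integrable_mul h.memLp
  rw [← integral_const_mul]
  have := integral_Ioi_zero_eq_neg_of_hasDerivAt
    (F := fun x : ℝ => P x * P x + (c * x + μ) * (w x * w x))
    (F' := fun x => c * (w x * w x))
    ((h.continuousOn_deriv_Ici.mul h.continuousOn_deriv_Ici).add
      (ContinuousOn.mul (by fun_prop) (h.continuousOn_Ici.mul h.continuousOn_Ici)))
    (fun x hx => by
      have hl : HasDerivAt (fun x : ℝ => c * x + μ) c x := by
        simpa using ((hasDerivAt_id x).ofReal_comp.const_mul c).add_const μ
      refine (((h.hasDerivAt_deriv x hx).mul (h.hasDerivAt_deriv x hx)).add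
        (hl.mul ((h.hasDerivAt x hx).mul (h.hasDerivAt x hx)))).congr_deriv ?_
      simp
      ring)
    ((h.memLp_deriv.integrable_mul h.memLp_deriv).add
      (((h.memLp_mul.integrable_mul h.memLp).const_mul c).add (hi.const_mul μ) |>.congr
        (.of_forall fun x : ℝ => by simp; ring)))
    (hi.const_mul c)
  rw [this]
  simp

end IsAirySolution

/-! ### Vanishing criteria on one half-line. -/

theorem eqOn_zero_of_setIntegral_nonpos {U : Set ℝ} (hU : IsOpen U) {F : ℝ → ℝ}
    (hc : ContinuousOn F U) (h0 : ∀ x ∈ U, 0 ≤ F x) (hi : IntegrableOn F U)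
    (hz : ∫ x in U, F x ≤ 0) : ∀ x ∈ U, F x = 0 := by
  have hnn : 0 ≤ᵐ[volume.restrict U] F := by
    filter_upwards [ae_restrict_mem hU.measurableSet] with x hx using h0 x hx
  have h1 : ∫ x in U, F x = 0 := le_antisymm hz (integral_nonneg_of_ae hnn)
  exact Measure.eqOn_open_of_ae_eq ((integral_eq_zero_iff_of_nonneg_ae hnn hi).1 h1) hU hc
    continuousOn_const

namespace IsAirySolution

variable {c μ : ℂ} {w P : ℝ → ℂ}

theorem eq_zero_of_eqOn_zero (h : IsAirySolution (Ioi 0) c μ 0 w P)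
    (hw : ∀ x ∈ Ioi (0 : ℝ), w x = 0) : w 0 = 0 ∧ P 0 = 0 := by
  have hPz : ∀ x ∈ Ioi (0 : ℝ), P x = 0 := fun x hx => by
    have h1 : HasDerivAt w 0 x := (hasDerivAt_const x (0 : ℂ)).congr_of_eventuallyEq (by
      filter_upwards [isOpen_Ioi.mem_nhds hx] with y hy using hw y hy)
    exact (h.hasDerivAt x hx).unique h1
  have hcl : (0 : ℝ) ∈ Ici (0 : ℝ) := self_mem_Ici
  have hsub : Ici (0 : ℝ) ⊆ closure (Ioi 0) := by rw [closure_Ioi]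
  exact ⟨(EqOn.of_subset_closure (g := fun _ => 0) hw h.continuousOn_Ici continuousOn_const
      Ioi_subset_Ici_self hsub) hcl,
    (EqOn.of_subset_closure (g := fun _ => 0) hPz h.continuousOn_deriv_Ici continuousOn_const
      Ioi_subset_Ici_self hsub) hcl⟩

/-- The imaginary part of the energy identity has no boundary term, so `(Im c · x + Im μ) |w|²` has
integral zero; after multiplication by `s` the weight is strictly positive for `x > 0`. -/
theorem eqOn_zero_of_im (h : IsAirySolution (Ioi 0) c μ 0 w P) {s : ℝ}
    (hs : 0 < s * c.im) (hμ : 0 ≤ s * μ.im) (hb : (P 0 * conj (w 0)).im = 0) :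
    ∀ x ∈ Ioi (0 : ℝ), w x = 0 := by
  have e : ∀ x : ℝ, (P x * conj (P x) - (c * x + μ) * (w x * conj (w x))).im
      = -((c.im * x + μ.im) * Complex.normSq (w x)) := fun x => by
    rw [Complex.mul_conj, Complex.mul_conj, Complex.sub_im, Complex.ofReal_im, Complex.im_mul_ofReal]
    simp
  have hi : IntegrableOn (fun x => s * ((c.im * x + μ.im) * Complex.normSq (w x))) (Ioi 0) := by
    refine (h.integrable_energy.im.const_mul (-s)).congr (.of_forall fun x => ?_)
    change -s * (P x * conj (P x) - (c * x + μ) * (w x * conj (w x))).im = _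
    rw [e]; ring
  have hz : ∫ x in Ioi (0 : ℝ), s * ((c.im * x + μ.im) * Complex.normSq (w x)) = 0 := by
    have h1 := Complex.imCLM.integral_comp_comm h.integrable_energy
    rw [h.integral_energy] at h1
    simp only [Complex.imCLM_apply, e, Complex.neg_im, hb, integral_neg, neg_zero] at h1
    rw [integral_const_mul, neg_eq_zero.1 h1, mul_zero]
  intro x hx
  have hpos : ∀ y ∈ Ioi (0 : ℝ), 0 < s * (c.im * y + μ.im) := fun y hy => by
    have := mul_pos hs hy
    linarith [mul_add s (c.im * y) μ.im, mul_assoc s c.im y]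
  have hwc : ContinuousOn w (Ioi 0) := h.continuousOn_Ici.mono Ioi_subset_Ici_self
  have := eqOn_zero_of_setIntegral_nonpos isOpen_Ioi
    (F := fun x => s * ((c.im * x + μ.im) * Complex.normSq (w x)))
    (continuousOn_const.mul (ContinuousOn.mul (by fun_prop)
      (Complex.continuous_normSq.comp_continuousOn hwc)))
    (fun y hy => by
      rw [← mul_assoc]
      exact mul_nonneg (hpos y hy).le (Complex.normSq_nonneg _)) hi hz.le x hx
  rw [← mul_assoc] at this
  exact Complex.normSq_eq_zero.1 ((mul_eq_zero.1 this).resolve_left (hpos x hx).ne')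

/-- For imaginary `c` and `μ = 0` the potential is purely imaginary and drops out of the real part.
-/
theorem re_energy_zero (hc : c.re = 0) (x : ℝ) :
    (P x * conj (P x) - (c * x + 0) * (w x * conj (w x))).re = Complex.normSq (P x) := by
  rw [Complex.mul_conj, Complex.mul_conj, Complex.sub_re, Complex.ofReal_re, Complex.re_mul_ofReal]
  simp [hc]

theorem integrable_normSq_deriv (h : IsAirySolution (Ioi 0) c 0 0 w P) (hc : c.re = 0) :
    IntegrableOn (fun x => Complex.normSq (P x)) (Ioi 0) :=
  h.integrable_energy.re.congr (.of_forall (re_energy_zero hc))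

theorem integral_normSq_deriv (h : IsAirySolution (Ioi 0) c 0 0 w P) (hc : c.re = 0) :
    ∫ x in Ioi (0 : ℝ), Complex.normSq (P x) = -(P 0 * conj (w 0)).re := by
  have h1 := Complex.reCLM.integral_comp_comm h.integrable_energy
  rw [h.integral_energy] at h1
  simpa only [Complex.reCLM_apply, re_energy_zero hc, Complex.neg_re] using h1

/-- Once `P = 0`, the equation itself reads `c x w = 0`. -/
theorem eqOn_zero_of_integral_normSq_deriv (h : IsAirySolution (Ioi 0) c 0 0 w P)
    (hc : c.re = 0) (hc0 : c ≠ 0) (hz : ∫ x in Ioi (0 : ℝ), Complex.normSq (P x) ≤ 0) :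
    ∀ x ∈ Ioi (0 : ℝ), w x = 0 := by
  have hPz : ∀ x ∈ Ioi (0 : ℝ), P x = 0 := fun x hx => Complex.normSq_eq_zero.1 <|
    eqOn_zero_of_setIntegral_nonpos isOpen_Ioi (F := fun x => Complex.normSq (P x))
      (Complex.continuous_normSq.comp_continuousOn
        (h.continuousOn_deriv_Ici.mono Ioi_subset_Ici_self))
      (fun y _ => Complex.normSq_nonneg _) (h.integrable_normSq_deriv hc) hz x hx
  intro x hx
  have h1 : HasDerivAt P 0 x := (hasDerivAt_const x (0 : ℂ)).congr_of_eventuallyEq (by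
    filter_upwards [isOpen_Ioi.mem_nhds hx] with y hy using hPz y hy)
  have h2 := (h.hasDerivAt_deriv x hx).unique h1
  have hx0 : (x : ℂ) ≠ 0 := Complex.ofReal_ne_zero.2 (ne_of_gt hx)
  simpa [hc0, hx0] using h2

end IsAirySolution

/-! ### Coupling the two half-lines through the transmission condition. -/

section Transmission

variable {μ : ℂ} {κ : ℝ} {w P w' P' : ℝ → ℂ}

/-- An eigenfunction whose boundary values on the two sides agree up to sign vanishes. -/
theorem eqOn_zero_of_boundary_eq_or_neg (h : IsAirySolution (Ioi 0) Complex.I μ 0 w P)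
    (h' : IsAirySolution (Ioi 0) (-Complex.I) μ 0 w' P') (hP : P' 0 = -P 0)
    (hκ : P 0 = κ * (w 0 - w' 0)) (hb : w 0 = w' 0 ∨ w 0 = -w' 0) :
    (∀ x ∈ Ioi (0 : ℝ), w x = 0) ∧ ∀ x ∈ Ioi (0 : ℝ), w' x = 0 := by
  -- With equal values the jump is zero and `t = 0`; with opposite values it is `2 w(0)` and `t =
  -- 2κ`. Real `t` makes `P(0)` times the conjugate of `w(0)` real.
  obtain ⟨t, ht⟩ : ∃ t : ℝ, P 0 = t * w 0 := by
    rcases hb with hb | hb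
    · exact ⟨0, by rw [hκ, hb]; simp⟩
    · refine ⟨2 * κ, ?_⟩
      rw [hκ, ← neg_eq_iff_eq_neg.2 hb]
      push_cast
      ring
  have him : (P 0 * conj (w 0)).im = 0 := by
    rw [ht, mul_assoc, Complex.mul_conj, ← Complex.ofReal_mul, Complex.ofReal_im]
  have him' : (P' 0 * conj (w' 0)).im = 0 := by
    rw [hP]
    rcases hb with hb | hb
    · rw [← hb, neg_mul, Complex.neg_im, him, neg_zero]
    · rw [← neg_eq_iff_eq_neg.2 hb, map_neg, neg_mul_neg, him]
  -- The sign of `Im μ` selects the side that vanishes first; its zero boundary values are the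
  -- Cauchy data of the other side.
  rcases le_total 0 μ.im with hμ | hμ
  · have hw := h.eqOn_zero_of_im (s := 1) (by simp) (by simpa using hμ) him
    obtain ⟨h1, h2⟩ := h.eq_zero_of_eqOn_zero hw
    refine ⟨hw, h'.eq_zero_of_cauchy ?_ (by rw [hP, h2, neg_zero])⟩
    rcases hb with hb | hb
    · rw [← hb, h1]
    · rw [← neg_eq_iff_eq_neg.2 hb, h1, neg_zero]
  · have hw := h'.eqOn_zero_of_im (s := -1) (by simp) (by simpa using hμ) him'
    obtain ⟨h1, h2⟩ := h'.eq_zero_of_eqOn_zero hw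
    refine ⟨h.eq_zero_of_cauchy ?_ (by rw [← neg_eq_zero, ← hP, h2]), hw⟩
    rcases hb with hb | hb <;> rw [hb, h1]
    exact neg_zero

/-- Adding the real energy identities gives `∫|P|² + ∫|P'|² = -κ |w(0) - w'(0)|²`; this is where the
sign of `κ` enters. -/
theorem eqOn_zero_of_eigenvalue_zero (hκ0 : 0 ≤ κ) (h : IsAirySolution (Ioi 0) Complex.I 0 0 w P)
    (h' : IsAirySolution (Ioi 0) (-Complex.I) 0 0 w' P') (hP : P' 0 = -P 0)
    (hκ : P 0 = κ * (w 0 - w' 0)) :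
    (∀ x ∈ Ioi (0 : ℝ), w x = 0) ∧ ∀ x ∈ Ioi (0 : ℝ), w' x = 0 := by
  have e := h.integral_normSq_deriv (by simp)
  have e' := h'.integral_normSq_deriv (by simp)
  have hsum : (P 0 * conj (w 0)).re + (P' 0 * conj (w' 0)).re
      = κ * Complex.normSq (w 0 - w' 0) := by
    rw [← Complex.add_re, hP, show P 0 * conj (w 0) + -P 0 * conj (w' 0)
      = P 0 * conj (w 0 - w' 0) by rw [map_sub]; ring, hκ, mul_assoc, Complex.mul_conj,
      ← Complex.ofReal_mul, Complex.ofReal_re]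
  have hnn : 0 ≤ κ * Complex.normSq (w 0 - w' 0) := mul_nonneg hκ0 (Complex.normSq_nonneg _)
  have n1 : 0 ≤ ∫ x in Ioi (0 : ℝ), Complex.normSq (P x) :=
    integral_nonneg fun _ => Complex.normSq_nonneg _
  have n2 : 0 ≤ ∫ x in Ioi (0 : ℝ), Complex.normSq (P' x) :=
    integral_nonneg fun _ => Complex.normSq_nonneg _
  exact ⟨h.eqOn_zero_of_integral_normSq_deriv (by simp) (by simp) (by linarith),
    h'.eqOn_zero_of_integral_normSq_deriv (by simp) (by simp) (by linarith)⟩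

/-- An eigenfunction that starts a Jordan chain vanishes. -/
theorem eqOn_zero_of_jordan_chain (hκ0 : 0 ≤ κ) {v Q v' Q' : ℝ → ℂ}
    (h : IsAirySolution (Ioi 0) Complex.I μ 0 w P)
    (h' : IsAirySolution (Ioi 0) (-Complex.I) μ 0 w' P') (hP : P' 0 = -P 0)
    (hκ : P 0 = κ * (w 0 - w' 0)) (k : IsAirySolution (Ioi 0) Complex.I μ w v Q)
    (k' : IsAirySolution (Ioi 0) (-Complex.I) μ w' v' Q') (hQ : Q' 0 = -Q 0)
    (hκQ : Q 0 = κ * (v 0 - v' 0)) :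
    (∀ x ∈ Ioi (0 : ℝ), w x = 0) ∧ ∀ x ∈ Ioi (0 : ℝ), w' x = 0 := by
  have e1 := h.integral_sq_eq_wronskian k
  have e2 := h'.integral_sq_eq_wronskian k'
  have e3 := h.mul_integral_sq
  have e4 := h'.mul_integral_sq
  rw [e1] at e3
  rw [e2, hP, hQ] at e4
  -- In the difference of the two identities `P(0)²` cancels, and so does `(w 0 - w' 0) Q 0 - P 0 (v
  -- 0 - v' 0)`, since both of its products equal `κ` times the two jumps.
  have hz : μ * ((w 0 - w' 0) * (w 0 + w' 0)) = 0 := by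
    rw [hκQ, hκ] at e3 e4
    linear_combination e3 - e4
  rcases mul_eq_zero.1 hz with rfl | hz
  · exact eqOn_zero_of_eigenvalue_zero hκ0 h h' hP hκ
  · refine eqOn_zero_of_boundary_eq_or_neg h h' hP hκ ?_
    exact (mul_eq_zero.1 hz).imp sub_eq_zero.1 eq_neg_of_add_eq_zero_left

end Transmission

/-! ### Passing between vectors of the Hilbert space and pairs of classical solutions. -/

theorem IsAirySolution.smul_sub_smul {I : Set ℝ} {c μ : ℂ} {w P v Q : ℝ → ℂ}
    (h : IsAirySolution I c μ 0 w P) (k : IsAirySolution I c μ 0 v Q) (a b : ℂ) :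
    IsAirySolution I c μ 0 (fun x => a * w x - b * v x) (fun x => a * P x - b * Q x) where
  continuousOn := (continuousOn_const.mul h.continuousOn).sub (continuousOn_const.mul k.continuousOn)
  continuousOn_deriv :=
    (continuousOn_const.mul h.continuousOn_deriv).sub (continuousOn_const.mul k.continuousOn_deriv)
  hasDerivAt x hx := ((h.hasDerivAt x hx).const_mul a).sub ((k.hasDerivAt x hx).const_mul b)
  hasDerivAt_deriv x hx := by
    refine (((h.hasDerivAt_deriv x hx).const_mul a).sub
      ((k.hasDerivAt_deriv x hx).const_mul b)).congr_deriv ?_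
    simp
    ring
  memLp := (h.memLp.const_mul a).sub (k.memLp.const_mul b)
  memLp_deriv := (h.memLp_deriv.const_mul a).sub (k.memLp_deriv.const_mul b)
  memLp_mul := by
    convert (h.memLp_mul.const_mul a).sub (k.memLp_mul.const_mul b) using 1
    funext x
    simp only [Pi.sub_apply]
    ring

/-- Classical representatives of a solution of `(L - μ) u = g`; the component on the left half-line
is reflected. -/
structure Represents (κ : ℝ) (μ : ℂ) (γ γ' : ℝ → ℂ) (u : H) (w P w' P' : ℝ → ℂ) : Prop where
  right : IsAirySolution (Ioi 0) Complex.I μ γ w P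
  left : IsAirySolution (Ioi 0) (-Complex.I) μ γ' w' P'
  deriv_eq : P' 0 = -P 0
  jump : P 0 = κ * (w 0 - w' 0)
  snd_ae : u.snd =ᵐ[volume.restrict (Ioi 0)] w
  fst_ae : u.fst =ᵐ[volume.restrict (Iio 0)] fun x => w' (-x)

theorem InGraph.exists_represents {κ : ℝ} {μ : ℂ} {u f g : H} (h : InGraph (-1) κ u f)
    (hf : f = μ • u + g) {γ γ' : ℝ → ℂ} (hγ : ContinuousOn γ (Ioi 0))
    (hγ' : ContinuousOn γ' (Ioi 0)) (hg : g.snd =ᵐ[volume.restrict (Ioi 0)] γ)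
    (hg' : g.fst =ᵐ[volume.restrict (Iio 0)] fun x => γ' (-x)) :
    ∃ w P w' P' : ℝ → ℂ, Represents κ μ γ γ' u w P w' P' := by
  obtain ⟨pm, qm, rm, pp, qp, rp, am, bm, ap, bp, hm, hp, e1, e2, e3, e4⟩ := h
  have f1 : f.fst = μ • u.fst + g.fst := by rw [hf]; simp
  have f2 : f.snd = μ • u.snd + g.snd := by rw [hf]; simp
  obtain ⟨w, P, hs, hw0, hP0, hw⟩ :=
    hp.exists_isAirySolution isOpen_Ioi ordConnected_Ioi e4 f2 hγ hg
  obtain ⟨v, Q, hs', hv0, hQ0, hv⟩ :=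
    hm.exists_isAirySolution isOpen_Iio ordConnected_Iio e3 f1
      (γ := fun x => γ' (-x)) (hγ'.comp continuous_neg.continuousOn fun x hx => by simpa using hx)
      hg'
  have hr := hs'.reflect
  simp only [neg_neg] at hr
  refine ⟨w, P, _, _, hs, hr, ?_, ?_, hw, ?_⟩
  · simp [hQ0, hP0, e1]
  · simp [hP0, hw0, hv0, e1, e2]
  · simpa using hv

theorem InGraph.exists_represents_eigenvector {κ : ℝ} {μ : ℂ} {u : H}
    (h : InGraph (-1) κ u (μ • u)) :
    ∃ w P w' P' : ℝ → ℂ, Represents κ μ 0 0 u w P w' P' :=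
  h.exists_represents (g := 0) (by simp) continuousOn_const continuousOn_const
    (Lp.coeFn_zero ℂ 2 _) (Lp.coeFn_zero ℂ 2 _)

namespace Represents

variable {κ : ℝ} {μ : ℂ} {γ γ' w P w' P' : ℝ → ℂ} {u : H}

theorem eq_zero (h : Represents κ μ γ γ' u w P w' P')
    (hz : (∀ x ∈ Ioi (0 : ℝ), w x = 0) ∧ ∀ x ∈ Ioi (0 : ℝ), w' x = 0) : u = 0 := by
  refine WithLp.ofLp_injective 2 (Prod.ext ?_ ?_)
  · change u.fst = 0
    apply Lp.ext
    filter_upwards [h.fst_ae, Lp.coeFn_zero ℂ 2 (volume.restrict (Iio 0)),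
      ae_restrict_mem measurableSet_Iio] with x h1 h2 h3
    rw [h1, h2]
    exact hz.2 (-x) (by simpa using h3)
  · change u.snd = 0
    apply Lp.ext
    filter_upwards [h.snd_ae, Lp.coeFn_zero ℂ 2 (volume.restrict (Ioi 0)),
      ae_restrict_mem measurableSet_Ioi] with x h1 h2 h3
    rw [h1, h2]
    exact hz.1 x h3

theorem smul_sub_smul {v : H} {y R y' R' : ℝ → ℂ} (h : Represents κ μ 0 0 u w P w' P')
    (k : Represents κ μ 0 0 v y R y' R') (a b : ℂ) :
    Represents κ μ 0 0 (a • u - b • v) (fun x => a * w x - b * y x) (fun x => a * P x - b * R x)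
      (fun x => a * w' x - b * y' x) (fun x => a * P' x - b * R' x) where
  right := h.right.smul_sub_smul k.right a b
  left := h.left.smul_sub_smul k.left a b
  deriv_eq := by rw [h.deriv_eq, k.deriv_eq]; ring
  jump := by rw [h.jump, k.jump]; ring
  snd_ae := by
    change (a • u.snd - b • v.snd : L2On (Ioi 0)) =ᵐ[volume.restrict (Ioi 0)] _
    filter_upwards [Lp.coeFn_sub (a • u.snd) (b • v.snd), Lp.coeFn_smul a u.snd,
      Lp.coeFn_smul b v.snd, h.snd_ae, k.snd_ae] with x h1 h2 h3 h4 h5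
    rw [h1, Pi.sub_apply, h2, h3, Pi.smul_apply, Pi.smul_apply, h4, h5, smul_eq_mul, smul_eq_mul]
  fst_ae := by
    change (a • u.fst - b • v.fst : L2On (Iio 0)) =ᵐ[volume.restrict (Iio 0)] _
    filter_upwards [Lp.coeFn_sub (a • u.fst) (b • v.fst), Lp.coeFn_smul a u.fst,
      Lp.coeFn_smul b v.fst, h.fst_ae, k.fst_ae] with x h1 h2 h3 h4 h5
    rw [h1, Pi.sub_apply, h2, h3, Pi.smul_apply, Pi.smul_apply, h4, h5, smul_eq_mul, smul_eq_mul]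

end Represents

/-- Eigenspaces of the transmission Airy operator are at most one-dimensional. -/
theorem exists_smul_eq_of_eigenvector {κ : ℝ} {μ : ℂ} {u v : H} (hu : InGraph (-1) κ u (μ • u))
    (hu0 : u ≠ 0) (hv : InGraph (-1) κ v (μ • v)) : ∃ a : ℂ, a • u = v := by
  obtain ⟨w, P, w', P', h⟩ := hu.exists_represents_eigenvector
  obtain ⟨y, R, y', R', k⟩ := hv.exists_represents_eigenvector
  have hd : w 0 - w' 0 ≠ 0 := fun hd => hu0 <| h.eq_zero <|
    eqOn_zero_of_boundary_eq_or_neg h.right h.left h.deriv_eq h.jump (.inl (sub_eq_zero.1 hd))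
  -- The coefficients are the two jumps, chosen so that the combination has none.
  have hc := h.smul_sub_smul k (y 0 - y' 0) (w 0 - w' 0)
  have h0 := hc.eq_zero (eqOn_zero_of_boundary_eq_or_neg hc.right hc.left hc.deriv_eq hc.jump
    (.inl (by ring)))
  refine ⟨(w 0 - w' 0)⁻¹ * (y 0 - y' 0), ?_⟩
  rw [mul_smul, sub_eq_zero.1 h0, inv_smul_smul₀ hd]

/-- Eigenvectors of the transmission Airy operator do not start Jordan chains. -/
theorem eq_zero_of_jordan_chain {κ : ℝ} (hκ : 0 ≤ κ) {μ : ℂ} {u v : H}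
    (hu : InGraph (-1) κ u (μ • u)) (hv : InGraph (-1) κ v (μ • v + u)) : u = 0 := by
  obtain ⟨w, P, w', P', h⟩ := hu.exists_represents_eigenvector
  obtain ⟨y, R, y', R', k⟩ := hv.exists_represents rfl
    (h.right.continuousOn.mono subset_closure) (h.left.continuousOn.mono subset_closure)
    h.snd_ae h.fst_ae
  exact h.eq_zero (eqOn_zero_of_jordan_chain hκ h.right h.left h.deriv_eq h.jump
    k.right k.left k.deriv_eq k.jump)

end TransmissionAiry

/-! ### Root spaces without Jordan chains, and the conclusion. -/

namespace UnboundedOp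

variable {E : Type*} [AddCommGroup E] [Module ℂ E]

theorem mem_kerPow_succ {T : E →ₗ.[ℂ] E} {μ : ℂ} {n : ℕ} {u : E} :
    u ∈ kerPow T μ (n + 1) ↔ ∃ v : T.domain, T v - μ • (v : E) ∈ kerPow T μ n ∧ (v : E) = u :=
  Iff.rfl

theorem mem_kerPow_one {T : E →ₗ.[ℂ] E} {μ : ℂ} {u : E} :
    u ∈ kerPow T μ 1 ↔ ∃ v : T.domain, T v = μ • (v : E) ∧ (v : E) = u := by
  rw [mem_kerPow_succ]
  simp only [kerPow, Submodule.mem_bot, sub_eq_zero]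

/-- If no eigenvector starts a Jordan chain, the root space is the eigenspace. -/
theorem rootSpace_eq_kerPow_one {T : E →ₗ.[ℂ] E} {μ : ℂ}
    (h : ∀ u v : T.domain, T u = μ • (u : E) → T v = μ • (v : E) + u → (u : E) = 0) :
    rootSpace T μ = kerPow T μ 1 := by
  refine le_antisymm (iSup_le fun n => ?_) (le_iSup (kerPow T μ) 1)
  induction n with
  | zero => exact bot_le
  | succ n ih =>
    intro u hu
    obtain ⟨v, hv, rfl⟩ := mem_kerPow_succ.1 hu
    obtain ⟨z, hz, hzv⟩ := mem_kerPow_one.1 (ih hv)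
    -- By induction `(T - μ) v` lies in the eigenspace, so it would start a chain continued by `v`;
    -- hence it is zero.
    have hz0 := h z v hz (by rw [hzv]; abel)
    exact mem_kerPow_one.2 ⟨v, by rwa [hzv, sub_eq_zero] at hz0, rfl⟩

end UnboundedOp

end

theorem lemma3p3 (κ : ℝ) (hκ : 0 ≤ κ) (μ : ℂ)
    (hμ : UnboundedOp.IsEigenvalue (TransmissionAiry.airyT (-1) κ) μ) :
    UnboundedOp.IsSimpleEigenvalue (TransmissionAiry.airyT (-1) κ) μ := by
  refine ⟨hμ, ?_⟩
  have hgraph := TransmissionAiry.airyT_inGraph (-1) κ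
  rw [UnboundedOp.rootSpace_eq_kerPow_one fun u v hu hv =>
    TransmissionAiry.eq_zero_of_jordan_chain hκ (hu ▸ hgraph u) (hv ▸ hgraph v)]
  obtain ⟨u, hu0, hu⟩ := hμ
  have hu0' : (u : TransmissionAiry.H) ≠ 0 := fun h => hu0 (Subtype.ext h)
  refine rank_eq_one
    (⟨(u : TransmissionAiry.H), UnboundedOp.mem_kerPow_one.2 ⟨u, hu, rfl⟩⟩ :
      UnboundedOp.kerPow (TransmissionAiry.airyT (-1) κ) μ 1)
    (fun h => hu0' (congrArg Subtype.val h)) ?_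
  rintro ⟨v, hv⟩
  obtain ⟨v, hTv, rfl⟩ := UnboundedOp.mem_kerPow_one.1 hv
  obtain ⟨a, ha⟩ := TransmissionAiry.exists_smul_eq_of_eigenvector (hu ▸ hgraph u) hu0'
    (hTv ▸ hgraph v)
  exact ⟨a, Subtype.ext ha⟩
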